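/- Let $G$ be a countable group, let $H\le G$ be a subgroup, and suppose that the action of $G$ by left translation on the set $G/H$ of left cosets is amenable, i.e. there is a $G$-invariant mean on $\ell^\infty(G/H)$. Then for every Gaussian action $a$ of $G$ on a standard probability space $(X,\mu)$, the co-induced action $\mathrm{CInd}_H^G(a|H)$ weakly contains $a$. Here the notions are the following. All actions are probability-measure-preserving (p.m.p.). *Gaussian actions.* Let $T$ be a countable set on which $G$ acts, and let $\varphi:T\times T\to\mathbb R$ be symmetric, positive definite ($\sum_{i,j\in F}c_ic_j\varphi(i,j)\ge 0$ for all finite $F\subseteq T$ and reals $c_i$) and $G$-invariant ($\varphi(g\cdot i,g\cdot j)=\varphi(i,j)$). Let $\mu_\varphi$ be the unique Borel probability measure on $\mathbb R^T$ for which every finite linear combination of the coordinate functions $p_i(x)=x(i)$ is a (possibly degenerate) centered Gaussian random variable and $\int p_ip_j\,d\mu_\varphi=\varphi(i,j)$ for all $i,j\in T$. The Gaussian shift $s_\varphi$ is the action $(s_\varphi(g)x)(i)=x(g^{-1}\cdot i)$ of $G$ on $(\mathbb R^T,\mu_\varphi)$. A p.m.p. action of $G$ is a Gaussian action if it is isomorphic,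 modulo null sets, to $s_\varphi$ for some such $T$ and $\varphi$. *Co-induction.* For a p.m.p. action $b$ of $H$ on $(X,\mu)$, let $Z=\{z\in X^G: b(h^{-1})z(g)=z(gh)\ \text{for all } h\in H,\ g\in G\}$. Let $\sigma:G/H\to G$ be any map with $\sigma(gH)\in gH$ for all $g\in G$ and $\sigma(H)=e$. The map $\Phi:Z\to X^{G/H}$, $\Phi(z)(gH)=z(\sigma(gH))$, is a bijection; let $\zeta$ be the pull-back under $\Phi$ of the product measure $\mu^{G/H}$. Then $\mathrm{CInd}_H^G(b)$ is the p.m.p. action of $G$ on $(Z,\zeta)$ given by $(g\cdot z)(f)=z(g^{-1}f)$. In the theorem, $b=a|H$ is the restriction of $a$ to $H$, and $\sigma$ is arbitrary. *Weak containment.* For p.m.p. actions $a$ of $G$ on $(X,\mu)$ and $b$ of $G$ on $(Y,\nu)$, a finite set $F\subseteq G$ and a measurable map $\phi:X\to\mathbb N$, let $\phi_a^F:X\to\mathbb N^F$ be $\phi_a^F(x)(f)=\phi(a(f)x)$, and similarly for $b$. The action $b$ weakly contains $a$ if for every $\epsilon>0$, every finite $F\subseteq G$ and every measurable $\phi:X\to\mathbb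 N$ there is a measurable $\psi:Y\to\mathbb N$ with $\|(\phi_a^F)_*\mu-(\psi_b^F)_*\nu\|_1\le\epsilon$, where $\|\cdot\|_1$ is the $\ell^1$-norm on the countable set $\mathbb N^F$. -/

import Mathlib

open MeasureTheory ProbabilityTheory

/-- A probability-measure-preserving (p.m.p.) action of the group `G` on `(X, μ)`. -/
structure PMPAction (G : Type*) [Group G] (X : Type*) [MeasurableSpace X] (μ : Measure X) where
  isProbabilityMeasure : IsProbabilityMeasure μ
  act : G → X → X
  one_act : ∀ x, act 1 x = x
  mul_act : ∀ g g' x, act (g * g') x = act g (act g' x)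
  measurePreserving : ∀ g, MeasurePreserving (act g) μ μ

namespace PMPAction

variable {G : Type*} [Group G] {X : Type*} [MeasurableSpace X] {μ : Measure X}

/-- The restriction `a | H` of an action to a subgroup. -/
def restrict (a : PMPAction G X μ) (H : Subgroup G) : PMPAction H X μ where
  isProbabilityMeasure := a.isProbabilityMeasure
  act h := a.act (h : G)
  one_act x := a.one_act x
  mul_act g g' x := a.mul_act g g' x
  measurePreserving h := a.measurePreserving h

/-- Isomorphism of p.m.p. actions: a measure space isomorphism modulo null sets which
intertwines the two actions almost everywhere. -/
def Isomorphic {Y : Type*} [MeasurableSpace Y] {ν : Measure Y}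
    (a : PMPAction G X μ) (b : PMPAction G Y ν) : Prop :=
  ∃ (f : X → Y) (k : Y → X), MeasurePreserving f μ ν ∧ MeasurePreserving k ν μ ∧
    (∀ᵐ x ∂μ, k (f x) = x) ∧ (∀ᵐ y ∂ν, f (k y) = y) ∧
    ∀ g : G, ∀ᵐ x ∂μ, f (a.act g x) = b.act g (f x)

/-- For an observable `φ : X → ℕ` and a finite `F ⊆ G`, the map `φ_a^F : X → ℕ^F`,
`φ_a^F (x) (f) = φ (a(f) x)`. -/
def observe (a : PMPAction G X μ) (F : Finset G) (φ : X → ℕ) (x : X) : F → ℕ :=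
  fun f => φ (a.act f x)

/-- The `ℓ¹`-distance `‖p - q‖₁` of two (finite) measures on a countable set. -/
noncomputable def l1Dist {S : Type*} [MeasurableSpace S] (p q : Measure S) : ℝ :=
  ∑' y : S, |p.real {y} - q.real {y}|

/-- `a.WeaklyContained b`, i.e. `a ≺ b`. -/
def WeaklyContained {Y : Type*} [MeasurableSpace Y] {ν : Measure Y}
    (a : PMPAction G X μ) (b : PMPAction G Y ν) : Prop :=
  ∀ ε : ℝ, 0 < ε → ∀ F : Finset G, ∀ φ : X → ℕ, Measurable φ →
    ∃ ψ : Y → ℕ, Measurable ψ ∧ l1Dist (μ.map (a.observe F φ)) (ν.map (b.observe F ψ)) ≤ ε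

end PMPAction

/-- A section `σ : G/H → G` of the space of left cosets of `H`, with `σ(H) = e`. -/
structure CosetSection {G : Type*} [Group G] (H : Subgroup G) where
  toFun : G ⧸ H → G
  mk_toFun : ∀ q : G ⧸ H, (toFun q : G ⧸ H) = q
  toFun_one : toFun ((1 : G) : G ⧸ H) = 1

namespace PMPAction

section Coinduction

variable {G : Type*} [Group G] {H : Subgroup G} {X : Type*} [MeasurableSpace X] {μ : Measure X}

/-- The space `Z = {z ∈ X^G : a(h⁻¹) z(g) = z(gh) for all h ∈ H, g ∈ G}`, with the σ-algebra
inherited from the product `X^G`. -/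
def CoindSpace (a : PMPAction H X μ) : Type _ :=
  {z : G → X // ∀ (h : H) (g : G), a.act h⁻¹ (z g) = z (g * h)}

instance (a : PMPAction H X μ) : MeasurableSpace a.CoindSpace :=
  inferInstanceAs (MeasurableSpace
    {z : G → X // ∀ (h : H) (g : G), a.act h⁻¹ (z g) = z (g * h)})

/-- The element `σ(gH)⁻¹ g` of `H`. -/
def sectionDiff (σ : CosetSection H) (g : G) : H :=
  ⟨(σ.toFun (g : G ⧸ H))⁻¹ * g, QuotientGroup.eq.1 (σ.mk_toFun (g : G ⧸ H))⟩

theorem section_mul_sectionDiff (σ : CosetSection H) (g : G) :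
    σ.toFun (g : G ⧸ H) * (sectionDiff σ g : G) = g := by
  simp [sectionDiff]

theorem sectionDiff_mul (σ : CosetSection H) (g : G) (h : H) :
    sectionDiff σ (g * h) = sectionDiff σ g * h := by
  have e : ((g * h : G) : G ⧸ H) = (g : G ⧸ H) := QuotientGroup.mk_mul_of_mem g h.2
  apply Subtype.ext
  simp only [sectionDiff, e, Subgroup.coe_mul, mul_assoc]

theorem sectionDiff_toFun (σ : CosetSection H) (q : G ⧸ H) : sectionDiff σ (σ.toFun q) = 1 := by
  apply Subtype.ext
  simp [sectionDiff, σ.mk_toFun]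

/-- The bijection `Φ : Z → X^{G/H}`, `Φ(z)(gH) = z(σ(gH))`, which is an isomorphism of
measurable spaces. -/
def coindEquiv (a : PMPAction H X μ) (σ : CosetSection H) :
    a.CoindSpace ≃ᵐ (G ⧸ H → X) where
  toFun z := fun q => z.1 (σ.toFun q)
  invFun y := ⟨fun g => a.act (sectionDiff σ g)⁻¹ (y (g : G ⧸ H)), by
    intro h g
    have e : ((g * h : G) : G ⧸ H) = (g : G ⧸ H) := QuotientGroup.mk_mul_of_mem g h.2
    change a.act h⁻¹ (a.act (sectionDiff σ g)⁻¹ (y (g : G ⧸ H))) =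
      a.act (sectionDiff σ (g * h))⁻¹ (y ((g * h : G) : G ⧸ H))
    rw [e, sectionDiff_mul, mul_inv_rev, a.mul_act]⟩
  left_inv z := by
    apply Subtype.ext
    funext g
    change a.act (sectionDiff σ g)⁻¹ (z.1 (σ.toFun (g : G ⧸ H))) = z.1 g
    rw [z.2 (sectionDiff σ g), section_mul_sectionDiff]
  right_inv y := by
    funext q
    change a.act (sectionDiff σ (σ.toFun q))⁻¹ (y ((σ.toFun q : G) : G ⧸ H)) = y q
    rw [sectionDiff_toFun, σ.mk_toFun, inv_one, a.one_act]
  measurable_toFun :=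
    measurable_pi_lambda _ fun q => (measurable_pi_apply (σ.toFun q)).comp measurable_subtype_coe
  measurable_invFun := by
    refine Measurable.subtype_mk (measurable_pi_lambda _ fun g => ?_)
    exact (a.measurePreserving _).measurable.comp (measurable_pi_apply _)

/-- The measure `ζ` on `Z`, the pull-back of the product measure `μ^{G/H}` under `Φ`. -/
noncomputable def coindMeasure (a : PMPAction H X μ) (σ : CosetSection H) :
    Measure a.CoindSpace :=
  (Measure.infinitePi fun _ : G ⧸ H => μ).map (a.coindEquiv σ).symm

/-- The action `(b(g) z)(f) = z(g⁻¹ f)` of `G` on `Z`. -/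
def coindAct (a : PMPAction H X μ) (g : G) (z : a.CoindSpace) : a.CoindSpace :=
  ⟨fun f => z.1 (g⁻¹ * f), fun h f => by rw [z.2 h, mul_assoc]⟩

theorem measurePreserving_coindEquiv (a : PMPAction H X μ) (σ : CosetSection H) :
    MeasurePreserving (a.coindEquiv σ) (a.coindMeasure σ)
      (Measure.infinitePi fun _ : G ⧸ H => μ) := by
  refine ⟨(a.coindEquiv σ).measurable, ?_⟩
  rw [coindMeasure, Measure.map_map (a.coindEquiv σ).measurable (a.coindEquiv σ).symm.measurable]
  simp

theorem measurePreserving_coindAct (a : PMPAction H X μ) (σ : CosetSection H) (g : G) :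
    MeasurePreserving (a.coindAct g) (a.coindMeasure σ) (a.coindMeasure σ) := by
  have := a.isProbabilityMeasure
  let P : Measure (G ⧸ H → X) := Measure.infinitePi fun _ : G ⧸ H => μ
  have hΦ : MeasurePreserving (a.coindEquiv σ) (a.coindMeasure σ) P :=
    a.measurePreserving_coindEquiv σ
  have h1 : MeasurePreserving (fun (y : G ⧸ H → X) (q : G ⧸ H) => y (g⁻¹ • q)) P P := by
    refine ⟨by fun_prop, ?_⟩
    have h := Measure.infinitePi_map_piCongrLeft (fun _ : G ⧸ H => μ) (MulAction.toPerm g)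
    have e : (fun (y : G ⧸ H → X) (q : G ⧸ H) => y (g⁻¹ • q)) =
        MeasurableEquiv.piCongrLeft (fun _ : G ⧸ H => X) (MulAction.toPerm g) := by
      funext y q
      simp [MeasurableEquiv.piCongrLeft, Equiv.piCongrLeft, Equiv.piCongrLeft']
    rw [e]
    exact h
  have h2 : MeasurePreserving (fun (y : G ⧸ H → X) (q : G ⧸ H) =>
      a.act (sectionDiff σ (g⁻¹ * σ.toFun q))⁻¹ (y q)) P P := by
    refine ⟨measurable_pi_lambda _ fun q =>
      (a.measurePreserving _).measurable.comp (measurable_pi_apply q), ?_⟩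
    have h := Measure.infinitePi_map_pi (fun _ : G ⧸ H => μ)
      (f := fun q => a.act (sectionDiff σ (g⁻¹ * σ.toFun q))⁻¹)
      (fun q => (a.measurePreserving _).measurable)
    refine h.trans ?_
    congr 1
    funext q
    exact (a.measurePreserving _).map_eq
  have h3 := (hΦ.symm (a.coindEquiv σ)).comp (h2.comp (h1.comp hΦ))
  convert h3 using 1
  funext z
  apply (a.coindEquiv σ).injective
  simp only [Function.comp_apply, MeasurableEquiv.apply_symm_apply]
  funext q
  change z.1 (g⁻¹ * σ.toFun q) =
    a.act (sectionDiff σ (g⁻¹ * σ.toFun q))⁻¹ (z.1 (σ.toFun (g⁻¹ • q)))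
  have e : g⁻¹ • q = ((g⁻¹ * σ.toFun q : G) : G ⧸ H) := by
    conv_lhs => rw [← σ.mk_toFun q]
    rfl
  rw [z.2, e, section_mul_sectionDiff]

/-- The co-induced action `CInd_H^G(a)` of `G` on `(Z, ζ)`. -/
noncomputable def coind (a : PMPAction H X μ) (σ : CosetSection H) :
    PMPAction G a.CoindSpace (a.coindMeasure σ) where
  isProbabilityMeasure := by
    have := a.isProbabilityMeasure
    exact Measure.isProbabilityMeasure_map (a.coindEquiv σ).symm.measurable.aemeasurable
  act := a.coindAct
  one_act z := by
    apply Subtype.ext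
    funext f
    simp [coindAct]
  mul_act g g' z := by
    apply Subtype.ext
    funext f
    simp [coindAct, mul_assoc]
  measurePreserving g := a.measurePreserving_coindAct σ g

end Coinduction

end PMPAction

/-- The action of `G` on `I` is amenable: there is a `G`-invariant mean on `ℓ^∞(I)`, i.e. a
positive normalized linear functional that is invariant under translation by `G`. -/
def IsAmenableAction (G : Type*) [Group G] (I : Type*) [MulAction G I] : Prop :=
  ∃ m : lp (fun _ : I => ℝ) ⊤ →ₗ[ℝ] ℝ,
    (∀ f : lp (fun _ : I => ℝ) ⊤, (∀ i, 0 ≤ f i) → 0 ≤ m f) ∧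
    (∀ f : lp (fun _ : I => ℝ) ⊤, (∀ i, f i = 1) → m f = 1) ∧
    ∀ (g : G) (f f' : lp (fun _ : I => ℝ) ⊤), (∀ i, f' i = f (g⁻¹ • i)) → m f' = m f

/-- Real positive definite functions on a set `T`. -/
structure IsPosDefFun {T : Type*} (φ : T → T → ℝ) : Prop where
  symm : ∀ i j, φ i j = φ j i
  nonneg : ∀ (F : Finset T) (c : T → ℝ), 0 ≤ ∑ i ∈ F, ∑ j ∈ F, c i * c j * φ i j

/-- `μ` is the Gaussian measure `μ_φ` on `ℝ^T`: it is the (unique) probability measure for which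
the coordinate functions are centered jointly Gaussian with covariance `φ`. -/
structure IsGaussianMeasure {T : Type*} (φ : T → T → ℝ) (μ : Measure (T → ℝ)) : Prop where
  map_linear_comb : ∀ (F : Finset T) (c : T → ℝ), ∃ v : NNReal,
    μ.map (fun x => ∑ i ∈ F, c i * x i) = gaussianReal 0 v
  integral_mul : ∀ i j : T, ∫ x, x i * x j ∂μ = φ i j

namespace IsGaussianMeasure

variable {T : Type*} {φ : T → T → ℝ} {μ ν : Measure (T → ℝ)}

theorem isProbabilityMeasure (h : IsGaussianMeasure φ μ) : IsProbabilityMeasure μ := by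
  obtain ⟨v, hv⟩ := h.map_linear_comb ∅ 0
  have : IsProbabilityMeasure (μ.map (fun x : T → ℝ => ∑ i ∈ (∅ : Finset T), (0 : T → ℝ) i * x i)) := by
    rw [hv]; infer_instance
  exact Measure.isProbabilityMeasure_of_map (fun x : T → ℝ => ∑ i ∈ (∅ : Finset T), (0 : T → ℝ) i * x i)

theorem memLp (h : IsGaussianMeasure φ μ) (i : T) : MemLp (fun x : T → ℝ => x i) 2 μ := by
  obtain ⟨v, hv⟩ := h.map_linear_comb {i} 1
  simp only [Finset.sum_singleton, Pi.one_apply, one_mul] at hv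
  have h2 : MemLp id 2 (μ.map fun x : T → ℝ => x i) := by
    rw [hv]; exact memLp_id_gaussianReal 2
  exact (memLp_map_measure_iff (g := id) (by fun_prop) (measurable_pi_apply i).aemeasurable).1 h2

theorem map_eq (h : IsGaussianMeasure φ μ) (F : Finset T) (c : T → ℝ) :
    μ.map (fun x => ∑ i ∈ F, c i * x i) =
      gaussianReal 0 (∑ i ∈ F, ∑ j ∈ F, c i * c j * φ i j).toNNReal := by
  obtain ⟨v, hv⟩ := h.map_linear_comb F c
  have e : ∫ y, y ^ 2 ∂(gaussianReal 0 v) = v := by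
    have := variance_id_gaussianReal (μ := 0) (v := v)
    rw [variance_of_integral_eq_zero (by fun_prop) (by simp)] at this
    simpa using this
  rw [← hv, integral_map (Measurable.aemeasurable (by fun_prop)) (by fun_prop)] at e
  have hs : ∀ x : T → ℝ, (∑ i ∈ F, c i * x i) ^ 2 =
      ∑ i ∈ F, ∑ j ∈ F, (c i * c j) * (x i * x j) := by
    intro x
    rw [sq, Finset.sum_mul_sum]
    exact Finset.sum_congr rfl fun i _ => Finset.sum_congr rfl fun j _ => by ring
  have hi : ∀ i j, Integrable (fun x : T → ℝ => (c i * c j) * (x i * x j)) μ := fun i j =>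
    ((h.memLp i).integrable_mul (h.memLp j)).const_mul _
  simp only [hs] at e
  rw [integral_finsetSum _ fun i _ => integrable_finsetSum _ fun j _ => hi i j] at e
  simp only [integral_finsetSum F fun j _ => hi _ j, integral_const_mul, h.integral_mul] at e
  rw [hv, e, Real.toNNReal_coe]

/-- The Gaussian measure associated to `φ` is unique. -/
theorem unique (h : IsGaussianMeasure φ μ) (h' : IsGaussianMeasure φ ν) : μ = ν := by
  classical
  have := h.isProbabilityMeasure
  have := h'.isProbabilityMeasure
  refine IsProjectiveLimit.unique (P := fun F : Finset T => ν.map F.restrict) (fun F => ?_)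
    (fun F => rfl)
  refine Measure.ext_of_charFunDual (funext fun L => ?_)
  rw [charFunDual_eq_charFun_map_one, charFunDual_eq_charFun_map_one,
    Measure.map_map (by fun_prop) (by fun_prop), Measure.map_map (by fun_prop) (by fun_prop)]
  let c : T → ℝ := fun i => if hi : i ∈ F then L (Pi.single ⟨i, hi⟩ 1) else 0
  have e : (L ∘ F.restrict : (T → ℝ) → ℝ) = fun x => ∑ i ∈ F, c i * x i := by
    funext x
    have : F.restrict x = ∑ i : F, x i • (Pi.single i (1 : ℝ) : F → ℝ) := by
      funext j
      simp [Finset.sum_apply, Pi.single_apply]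
    rw [Function.comp_apply, this, map_sum, ← Finset.sum_coe_sort F]
    exact Finset.sum_congr rfl fun i _ => by simp [c, mul_comm]
  rw [e, h.map_eq, h'.map_eq]

/-- If `φ` is `G`-invariant then the shift action of `G` on `ℝ^T` preserves `μ_φ`. -/
theorem measurePreserving_shift {G : Type*} [Group G] [MulAction G T]
    (h : IsGaussianMeasure φ μ) (hφ : ∀ (g : G) (i j : T), φ (g • i) (g • j) = φ i j) (g : G) :
    MeasurePreserving (fun (x : T → ℝ) (i : T) => x (g⁻¹ • i)) μ μ := by
  classical
  have hm : Measurable (fun (x : T → ℝ) (i : T) => x (g⁻¹ • i)) := by fun_prop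
  refine ⟨hm, unique (φ := φ) ⟨fun F c => ?_, fun i j => ?_⟩ h⟩
  · obtain ⟨v, hv⟩ := h.map_linear_comb (F.image (g⁻¹ • ·)) (fun i => c (g • i))
    refine ⟨v, ?_⟩
    rw [← hv, Measure.map_map (by fun_prop) hm]
    congr 1
    funext x
    rw [Finset.sum_image fun i _ j _ hij => MulAction.injective g⁻¹ hij]
    simp
  · rw [integral_map hm.aemeasurable (by fun_prop), h.integral_mul, hφ]

end IsGaussianMeasure

/-- The Gaussian shift `s_φ` of `G` on `(ℝ^T, μ_φ)`, `(s_φ(g) x)(i) = x(g⁻¹ • i)`. -/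
def gaussianShift {G : Type*} [Group G] {T : Type*} [MulAction G T] {φ : T → T → ℝ}
    {μ : Measure (T → ℝ)} (h : IsGaussianMeasure φ μ)
    (hφ : ∀ (g : G) (i j : T), φ (g • i) (g • j) = φ i j) : PMPAction G (T → ℝ) μ where
  isProbabilityMeasure := h.isProbabilityMeasure
  act g x := fun i => x (g⁻¹ • i)
  one_act x := by simp
  mul_act g g' x := by simp [mul_smul]
  measurePreserving g := h.measurePreserving_shift hφ g

/-- A Gaussian action: a p.m.p. action isomorphic to the Gaussian shift `s_φ` of some invariant
positive definite function `φ` on a countable `G`-set `T`. -/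
def IsGaussianAction.{w, u, v} {G : Type u} [Group G] {X : Type v} [MeasurableSpace X]
    {μ : Measure X} (a : PMPAction G X μ) : Prop :=
  ∃ (T : Type w) (_ : Countable T) (_ : MulAction G T) (φ : T → T → ℝ) (_ : IsPosDefFun φ)
    (hφ : ∀ (g : G) (i j : T), φ (g • i) (g • j) = φ i j)
    (γ : Measure (T → ℝ)) (hγ : IsGaussianMeasure φ γ), a.Isomorphic (gaussianShift hγ hφ)

universe u v w

/-!
The idea is to average independent copies of the Gaussian action over `G ⧸ H` with almost invariant
weights.

*Coordinates.* For `z` in the space of the co-induced action, the point `a(x) z(x)` depends only on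
the coset `xH` (`PMPAction.coindCoord_mk`). The resulting family `w ∈ X^{G/H}` is independent with
law `μ` (`PMPAction.measurePreserving_coindCoord`), and in these coordinates `g` acts by
`(g • w)(q) = a(g) w(g⁻¹ • q)` (`PMPAction.coindCoord_coindAct`): it permutes the copies of `X`
while acting diagonally on them.

*Averages.* Let `f : X → ℝ^T` be the isomorphism with a Gaussian shift. For a finitely supported
unit vector `ξ` in `ℓ²(G/H)`, put `Y = ∑ q, ξ q • f (w q)`. A sum of independent centered Gaussians
with weights whose squares sum to one has the same covariance, so `Y` has law `μ_φ` exactly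
(`measurePreserving_coindAverage`). The action on `ℝ^T` is linear, so `Y(g • z) - g • Y(z)` is again
such a sum, with weights `ξ (g • q) - ξ q`; its `i`-th coordinate has variance
`‖g⁻¹ξ - ξ‖² φ(g⁻¹i, g⁻¹i)` (`coindAverage_coindAct_sub`).

*Amenability.* The invariant mean yields unit vectors `ξ` for which `‖g⁻¹ξ - ξ‖` is as small as
desired for all `g` in a given finite set (`IsAmenableAction.exists_almost_invariant_unit_vector`):
otherwise a Hahn-Banach separation in a finite power of `ℓ¹(G/H)` would give finitely many bounded
functions `k_g` with `∑ g, (k_g (g⁻¹ • q) - k_g q)` bounded below by a positive constant, while the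
mean of that sum is zero.

*Conclusion.* Along such a sequence of `ξ`, the variables `Y(g • z)` and `g • Y(z)` all have law
`μ_φ`, and their difference tends to zero in measure. As the law is fixed, every measurable
`θ : ℝ^T → ℕ`, and not just a continuous one, eventually takes the same value on both off a set of
small measure (`tendsto_measure_symmDiff_preimage_pi`, `tendsto_measure_ne_of_symmDiff_preimage`).
Hence the observable `θ ∘ Y` on the co-induced action has almost the same joint distribution over
`F` as `θ` on the Gaussian shift.
-/

/-! ### Almost invariant unit vectors from an invariant mean -/

/-- Reiter's condition: an amenable action has finitely supported probability densities that are
almost invariant in `ℓ¹`. The `ℓ¹`-norm is expressed by a bound on all finite partial sums. -/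
theorem IsAmenableAction.exists_almost_invariant_density {G Q : Type*} [Group G] [MulAction G Q]
    (h : IsAmenableAction G Q) (F : Finset G) {ε : ℝ} (hε : 0 < ε) :
    ∃ p : Q →₀ ℝ, (∀ q, 0 ≤ p q) ∧ ∑ q ∈ p.support, p q = 1 ∧
      ∀ g ∈ F, ∀ s : Finset Q, ∑ q ∈ s, |p (g • q) - p q| ≤ ε := by
  classical
  obtain ⟨m, hpos, hone, hinv⟩ := h
  let δ : Q → lp (fun _ : Q => ℝ) 1 := fun q => lp.single 1 q (1 : ℝ)
  let v : Q → (F → lp (fun _ : Q => ℝ) 1) := fun q g => δ ((g : G)⁻¹ • q) - δ q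
  let L : (Q →₀ ℝ) →ₗ[ℝ] (F → lp (fun _ : Q => ℝ) 1) := Finsupp.linearCombination ℝ v
  let D : Set (Q →₀ ℝ) :=
    {p | (∀ q, 0 ≤ p q) ∧ Finsupp.linearCombination ℝ (fun _ => (1 : ℝ)) p = 1}
  have hD : Convex ℝ D := by
    rintro x ⟨hx0, hx1⟩ y ⟨hy0, hy1⟩ a b ha hb hab
    refine ⟨fun q => ?_, by simp [map_add, map_smul, hx1, hy1, hab]⟩
    have := hx0 q
    have := hy0 q
    simp only [Finsupp.add_apply, Finsupp.smul_apply, smul_eq_mul]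
    positivity
  -- `L p g` is the function `q ↦ p (g • q) - p q`; the set `L '' D` must come close to zero
  have key : (0 : F → lp (fun _ : Q => ℝ) 1) ∈ closure (L '' D) := by
    by_contra hcl
    obtain ⟨f, u, hu, hf⟩ := geometric_hahn_banach_point_closed
      (hD.linear_image L).closure isClosed_closure hcl
    rw [map_zero] at hu
    -- the bounded functions on `Q` which represent the functional `f`
    let k : F → Q → ℝ := fun g q => f (Pi.single g (δ q))
    have hk (g : F) (q : Q) : ‖k g q‖ ≤ ‖f‖ := by
      refine (f.le_opNorm _).trans ?_
      rw [Pi.norm_single, lp.norm_single (by norm_num)]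
      simp
    have hmem (g : F) (t : G) : Memℓp (fun q => k g (t • q)) ⊤ :=
      memℓp_infty ⟨‖f‖, by rintro _ ⟨q, rfl⟩; exact hk g _⟩
    let K : F → G → lp (fun _ : Q => ℝ) ⊤ := fun g t => ⟨fun q => k g (t • q), hmem g t⟩
    let one : lp (fun _ : Q => ℝ) ⊤ :=
      ⟨fun _ => 1, memℓp_infty ⟨1, by rintro _ ⟨q, rfl⟩; simp⟩⟩
    have hfv (q : Q) : f (v q) = ∑ g, (k g ((g : G)⁻¹ • q) - k g q) := by
      have : v q = ∑ g, Pi.single g (v q g) := (Finset.univ_sum_single (v q)).symm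
      rw [this, map_sum]
      refine Finset.sum_congr rfl fun g _ => ?_
      simp only [v, k, Pi.single_sub, map_sub]
    have hlt (q : Q) : u < f (v q) := by
      refine hf _ (subset_closure ⟨Finsupp.single q 1, ⟨fun q' => ?_, by simp⟩, by simp [L]⟩)
      rw [Finsupp.single_apply]
      split_ifs <;> simp
    -- the mean of `∑ g, (k g (g⁻¹ • q) - k g q) - u ≥ 0` is `-u < 0`
    have h0 : 0 ≤ m (∑ g, (K g (g : G)⁻¹ - K g 1) - u • one) := by
      refine hpos _ fun q => ?_
      have := hfv q ▸ (hlt q).le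
      simp only [lp.coeFn_sub, lp.coeFn_sum, lp.coeFn_smul, Pi.sub_apply, Finset.sum_apply,
        Pi.smul_apply, smul_eq_mul]
      simpa [K, one] using this
    rw [map_sub, map_sum, map_smul, hone one fun _ => rfl, Finset.sum_eq_zero] at h0
    · simp at h0; linarith
    · intro g _
      rw [map_sub, sub_eq_zero]
      exact hinv g _ _ fun q => by simp [K]
  obtain ⟨_, ⟨p, ⟨hp0, hp1⟩, rfl⟩, hp⟩ := Metric.mem_closure_iff.1 key ε hε
  rw [dist_zero_left] at hp
  refine ⟨p, hp0, by simpa [Finsupp.linearCombination_apply, Finsupp.sum] using hp1,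
    fun g hg s => ?_⟩
  have hval (q : Q) : (L p ⟨g, hg⟩ : Q → ℝ) q = p (g • q) - p q := by
    have hδ (q' : Q) : (v q' ⟨g, hg⟩ : Q → ℝ) q =
        (if q' = g • q then 1 else 0) - (if q' = q then 1 else 0) := by
      simp only [v, δ, lp.coeFn_sub, Pi.sub_apply, lp.single_apply, Pi.single_apply,
        eq_comm (a := q), inv_smul_eq_iff]
    simp only [L, Finsupp.linearCombination_apply, Finsupp.sum, Finset.sum_apply, Pi.smul_apply,
      lp.coeFn_sum, lp.coeFn_smul, smul_eq_mul, hδ, mul_sub, Finset.sum_sub_distrib]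
    simp +contextual [eq_comm]
  have h1 := lp.sum_rpow_le_norm_rpow (p := 1) (by norm_num) (L p ⟨g, hg⟩) s
  simp only [ENNReal.toReal_one, Real.rpow_one, hval, Real.norm_eq_abs] at h1
  exact h1.trans ((norm_le_pi_norm _ _).trans hp.le)

/-- The `ℓ²` form of Reiter's condition, obtained by taking square roots of densities. -/
theorem IsAmenableAction.exists_almost_invariant_unit_vector {G Q : Type*} [Group G]
    [MulAction G Q] (h : IsAmenableAction G Q) (F : Finset G) {ε : ℝ} (hε : 0 < ε) :
    ∃ ξ : Q →₀ ℝ, ∑ q ∈ ξ.support, ξ q ^ 2 = 1 ∧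
      ∀ g ∈ F, ∀ s : Finset Q, ∑ q ∈ s, (ξ (g • q) - ξ q) ^ 2 ≤ ε := by
  obtain ⟨p, hp0, hp1, hp⟩ := h.exists_almost_invariant_density F hε
  refine ⟨p.mapRange Real.sqrt Real.sqrt_zero, ?_, fun g hg s => le_trans ?_ (hp g hg s)⟩
  · rw [← hp1]
    refine (Finset.sum_subset Finsupp.support_mapRange fun q _ hq => ?_).trans
      (Finset.sum_congr rfl fun q _ => by simp [Real.sq_sqrt (hp0 q)])
    rw [Finsupp.notMem_support_iff.1 hq, zero_pow two_ne_zero]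
  · refine Finset.sum_le_sum fun q _ => ?_
    simp only [Finsupp.mapRange_apply]
    -- `(√a - √b)² ≤ |√a - √b| (√a + √b) = |a - b|`
    have ha := Real.sq_sqrt (hp0 (g • q))
    have hb := Real.sq_sqrt (hp0 q)
    have ha' := Real.sqrt_nonneg (p (g • q))
    have hb' := Real.sqrt_nonneg (p q)
    rw [← ha, ← hb, Real.sqrt_sq ha', Real.sqrt_sq hb', sq_sub_sq, abs_mul,
      abs_of_nonneg (add_nonneg ha' hb'), ← sq_abs, sq]
    gcongr
    rw [abs_le]
    constructor <;> linarith

/-! ### Weighted sums of independent copies of a Gaussian measure -/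

/-- Linear combinations of i.i.d. centered Gaussian variables are Gaussian. -/
theorem gaussianReal_map_sum_infinitePi {Q E : Type*} [MeasurableSpace E] {γ : Measure E}
    [IsProbabilityMeasure γ] {f : E → ℝ} (hf : Measurable f) {v : NNReal}
    (hv : γ.map f = gaussianReal 0 v) (s : Finset Q) (c : Q → ℝ) :
    (Measure.infinitePi fun _ : Q => γ).map (fun y => ∑ q ∈ s, c q * f (y q)) =
      gaussianReal 0 (∑ q ∈ s, c q ^ 2 * (v : ℝ)).toNNReal := by
  have hm (q : Q) : Measurable fun x : E => c q * f x := hf.const_mul _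
  have hmap (q : Q) : (Measure.infinitePi fun _ : Q => γ).map (fun y => c q * f (y q)) =
      gaussianReal 0 ((c q ^ 2).toNNReal * v) := by
    have h1 := gaussianReal_map_const_mul (μ := 0) (v := v) (c q)
    rw [mul_zero, ← hv, ← Measure.infinitePi_map_eval (fun _ : Q => γ) q,
      Measure.map_map hf (by fun_prop), Measure.map_map (by fun_prop) (by fun_prop)] at h1
    rw [Real.toNNReal_of_nonneg (sq_nonneg (c q))]
    exact h1
  have hind : iIndepFun (fun q (y : Q → E) => c q * f (y q)) (Measure.infinitePi fun _ : Q => γ) :=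
    iIndepFun_infinitePi (P := fun _ : Q => γ) hm
  have : IsProbabilityMeasure ((Measure.infinitePi fun _ : Q => γ).map
      (fun y => ∑ q ∈ s, c q * f (y q))) :=
    Measure.isProbabilityMeasure_map (Measurable.aemeasurable (by fun_prop))
  refine Measure.ext_of_charFun ?_
  rw [(hind.restrict s).charFun_map_fun_finsetSum_eq_prod
    fun q _ => Measurable.aemeasurable (by fun_prop)]
  funext t
  simp only [hmap, Finset.prod_apply, charFun_gaussianReal, ← Complex.exp_sum]
  rw [Real.coe_toNNReal _ (Finset.sum_nonneg fun q _ => by positivity)]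
  congr 1
  simp [Finset.sum_mul, Finset.sum_div, sq_nonneg]

/-- The variances of the linear combinations determine the covariance, so it is enough to know the
former. -/
theorem IsGaussianMeasure.of_map_eq {T : Type*} {φ : T → T → ℝ} (hφ : ∀ i j, φ i j = φ j i)
    {ν : Measure (T → ℝ)}
    (h : ∀ (F : Finset T) (c : T → ℝ), ∃ v : NNReal,
      (v : ℝ) = ∑ i ∈ F, ∑ j ∈ F, c i * c j * φ i j ∧
      ν.map (fun x => ∑ i ∈ F, c i * x i) = gaussianReal 0 v) :
    IsGaussianMeasure φ ν := by
  classical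
  -- `ν` is Gaussian for its own covariance, which remains to be identified with `φ`
  have hG : IsGaussianMeasure (fun i j => ∫ x, x i * x j ∂ν) ν :=
    ⟨fun F c => (h F c).imp fun _ hv => hv.2, fun _ _ => rfl⟩
  -- the nonnegativity `h0` discards the truncation in `IsGaussianMeasure.map_eq`
  have hvar (F : Finset T) (c : T → ℝ) : ∑ i ∈ F, ∑ j ∈ F, c i * c j * (∫ x, x i * x j ∂ν) =
      ∑ i ∈ F, ∑ j ∈ F, c i * c j * φ i j := by
    obtain ⟨v, hv, hm⟩ := h F c
    have h0 : 0 ≤ ∑ i ∈ F, ∑ j ∈ F, c i * c j * (∫ x, x i * x j ∂ν) := by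
      have hi (i j : T) : Integrable (fun x : T → ℝ => (c i * x i) * (c j * x j)) ν := by
        simpa only [mul_mul_mul_comm, Pi.mul_apply] using
          ((hG.memLp i).integrable_mul (hG.memLp j)).const_mul (c i * c j)
      have : 0 ≤ ∫ x, (∑ i ∈ F, c i * x i) * (∑ i ∈ F, c i * x i) ∂ν :=
        integral_nonneg fun x => mul_self_nonneg _
      simp only [Finset.sum_mul_sum] at this
      rw [integral_finsetSum _ fun i _ => integrable_finsetSum _ fun j _ => hi i j] at this
      simp only [integral_finsetSum F fun j _ => hi _ j] at this
      simpa only [mul_mul_mul_comm, integral_const_mul] using this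
    have e := (hG.map_eq F c).symm.trans hm
    rw [gaussianReal_ext_iff] at e
    rw [← hv, ← e.2, Real.coe_toNNReal _ h0]
  refine ⟨hG.map_linear_comb, fun i j => ?_⟩
  have hd (i : T) : ∫ x, x i * x i ∂ν = φ i i := by simpa using hvar {i} 1
  rcases eq_or_ne i j with rfl | hij
  · exact hd i
  · -- polarization: apply `hvar` to `x i + x j`
    have h2 := hvar {i, j} 1
    simp only [Finset.sum_pair hij, Pi.one_apply, one_mul, hd, hφ j i] at h2
    have h3 : ∫ x, x j * x i ∂ν = ∫ x, x i * x j ∂ν := by simp only [mul_comm]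
    linarith

/-- A linear combination, with weights `c`, of independent vectors of law `μ_φ` is Gaussian with
covariance `(∑ q, c q ^ 2) φ`. -/
theorem IsGaussianMeasure.map_sum_infinitePi {Q T : Type*} {φ : T → T → ℝ}
    (hφ : IsPosDefFun φ) {γ : Measure (T → ℝ)} (h : IsGaussianMeasure φ γ) (s : Finset Q)
    (c : Q → ℝ) :
    IsGaussianMeasure (fun i j => (∑ q ∈ s, c q ^ 2) * φ i j)
      ((Measure.infinitePi fun _ : Q => γ).map fun y i => ∑ q ∈ s, c q * y q i) := by
  have := h.isProbabilityMeasure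
  refine .of_map_eq (fun i j => by rw [hφ.symm]) fun F d => ?_
  have h0 := hφ.nonneg F d
  refine ⟨_, ?_, Eq.trans ?_ (gaussianReal_map_sum_infinitePi
    (f := fun x : T → ℝ => ∑ i ∈ F, d i * x i) (by fun_prop) (h.map_eq F d) s c)⟩
  rotate_left
  · rw [Measure.map_map (by fun_prop) (by fun_prop)]
    have e : ((fun x : T → ℝ => ∑ i ∈ F, d i * x i) ∘ fun (y : Q → T → ℝ) i =>
        ∑ q ∈ s, c q * y q i) = fun y => ∑ q ∈ s, c q * ∑ i ∈ F, d i * y q i := by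
      funext y
      simp only [Function.comp_apply, Finset.mul_sum]
      rw [Finset.sum_comm]
      exact Finset.sum_congr rfl fun q _ => Finset.sum_congr rfl fun i _ => by ring
    rw [e]
  · rw [Real.coe_toNNReal _ h0, Real.coe_toNNReal _
      (Finset.sum_nonneg fun q _ => mul_nonneg (sq_nonneg _) h0), ← Finset.sum_mul]
    simp only [Finset.mul_sum]
    exact Finset.sum_congr rfl fun i _ => Finset.sum_congr rfl fun j _ => by ring

/-- Chebyshev's inequality for a coordinate. -/
theorem IsGaussianMeasure.measureReal_abs_ge_le {T : Type*} {φ : T → T → ℝ}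
    {ν : Measure (T → ℝ)} (h : IsGaussianMeasure φ ν) (i : T) {δ : ℝ} (hδ : 0 < δ) :
    ν.real {x | δ ≤ |x i|} ≤ φ i i / δ ^ 2 := by
  have hm := mul_meas_ge_le_integral_of_nonneg (μ := ν) (f := fun x : T → ℝ => x i * x i)
    (.of_forall fun x => mul_self_nonneg _) ((h.memLp i).integrable_mul (h.memLp i)) (δ ^ 2)
  have hset : {x : T → ℝ | δ ^ 2 ≤ x i * x i} = {x | δ ≤ |x i|} := by
    ext x
    rw [Set.mem_ofPred_eq, Set.mem_ofPred_eq, ← sq, sq_le_sq, abs_of_pos hδ]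
  rw [h.integral_mul, hset] at hm
  rwa [le_div_iff₀ (by positivity), mul_comm]

/-! ### Distance between laws, and random variables with a fixed law that become close -/

/-- The coupling inequality: the laws of two random variables on the same space are close if the
variables are equal with high probability. -/
theorem PMPAction.l1Dist_map_le {Ω S : Type*} [MeasurableSpace Ω] [MeasurableSpace S]
    [Countable S] [MeasurableSingletonClass S] {P : Measure Ω} [IsFiniteMeasure P] {u v : Ω → S}
    (hu : Measurable u) (hv : Measurable v) :
    PMPAction.l1Dist (P.map u) (P.map v) ≤ 2 * P.real {x | u x ≠ v x} := by
  let R : Measure Ω := P.restrict {x | u x ≠ v x}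
  have hsum {w : Ω → S} (hw : Measurable w) :
      HasSum (fun y => R.real (w ⁻¹' {y})) (P.real {x | u x ≠ v x}) := by
    have h := tsum_measure_preimage_singleton (μ := R) Set.countable_univ (f := w)
      fun y _ => hw (measurableSet_singleton y)
    rw [tsum_univ fun y => R (w ⁻¹' {y}), Set.preimage_univ, Measure.restrict_apply_univ] at h
    have h2 := ENNReal.hasSum_toReal (f := fun y => R (w ⁻¹' {y}))
      (h ▸ measure_ne_top P _)
    rw [← ENNReal.tsum_toReal_eq fun y => measure_ne_top _ _, h] at h2
    exact h2
  -- `w = y` implies `w' = y`, unless the two variables differ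
  have hle {w w' : Ω → S} (hw : Measurable w) (y : S)
      (hww : ∀ x, w x ≠ w' x → u x ≠ v x) :
      P.real (w ⁻¹' {y}) ≤ P.real (w' ⁻¹' {y}) + R.real (w ⁻¹' {y}) := by
    rw [measureReal_restrict_apply (hw (measurableSet_singleton y))]
    refine (measureReal_mono fun x hx => ?_).trans (measureReal_union_le _ _)
    by_cases h : w x = w' x
    · exact Or.inl (h.symm.trans hx)
    · exact Or.inr ⟨hx, hww x h⟩
  have hb := (hsum hu).add (hsum hv)
  have hpt (y : S) : |(P.map u).real {y} - (P.map v).real {y}| ≤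
      R.real (u ⁻¹' {y}) + R.real (v ⁻¹' {y}) := by
    rw [map_measureReal_apply hu (measurableSet_singleton y),
      map_measureReal_apply hv (measurableSet_singleton y), abs_sub_le_iff]
    have h1 := hle hu (w' := v) y fun _ h => h
    have h2 := hle hv (w' := u) y fun _ h => h.symm
    have h3 : 0 ≤ R.real (u ⁻¹' {y}) := measureReal_nonneg
    have h4 : 0 ≤ R.real (v ⁻¹' {y}) := measureReal_nonneg
    constructor <;> linarith
  have hs : Summable fun y => |(P.map u).real {y} - (P.map v).real {y}| :=
    .of_nonneg_of_le (fun _ => abs_nonneg _) hpt hb.summable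
  calc PMPAction.l1Dist (P.map u) (P.map v)
      ≤ ∑' y, (R.real (u ⁻¹' {y}) + R.real (v ⁻¹' {y})) := hs.tsum_le_tsum hpt hb.summable
    _ = 2 * P.real {x | u x ≠ v x} := by rw [hb.tsum_eq, two_mul]

section Agreement

open Filter Topology

theorem measurableSet_accumulate {E : Type*} [MeasurableSpace E] {f : ℕ → Set E}
    (hf : ∀ k, MeasurableSet (f k)) (N : ℕ) : MeasurableSet (Set.accumulate f N) :=
  .biUnion (Set.to_countable _) fun k _ => hf k

/-- Continuity from above, for the tails of a union. -/
theorem tendsto_measure_iUnion_diff_accumulate {E : Type*} [MeasurableSpace E] {γ : Measure E}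
    [IsFiniteMeasure γ] {f : ℕ → Set E} (hf : ∀ k, MeasurableSet (f k)) :
    Tendsto (fun N => γ ((⋃ k, f k) \ Set.accumulate f N)) atTop (𝓝 0) := by
  have h := ENNReal.Tendsto.sub (tendsto_const_nhds (x := γ (⋃ k, f k)))
    (tendsto_measure_iUnion_accumulate (μ := γ) (f := f)) (Or.inl (measure_ne_top _ _))
  rw [tsub_self] at h
  refine h.congr fun N => (measure_sdiff ?_ ?_ (measure_ne_top _ _)).symm
  · exact Set.accumulate_subset_iUnion N
  · exact (measurableSet_accumulate hf N).nullMeasurableSet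

variable {Ω E ι : Type*} [MeasurableSpace Ω] {P : Measure Ω} {l : Filter ι}

/-- For random variables `U n`, `V n` of the same fixed law, the sets `A` such that `U n ∈ A` and
`V n ∈ A` are asymptotically equivalent form a σ-algebra. The fixed law gives a uniform bound on the
tails of a countable union. -/
theorem tendsto_measure_symmDiff_preimage_of_generateFrom [mE : MeasurableSpace E]
    {γ : Measure E} [IsFiniteMeasure γ] {U V : ι → Ω → E}
    (hU : ∀ n, MeasurePreserving (U n) P γ) (hV : ∀ n, MeasurePreserving (V n) P γ)
    {C : Set (Set E)} (hC : mE = MeasurableSpace.generateFrom C)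
    (h : ∀ A ∈ C, Tendsto (fun n => P (symmDiff (U n ⁻¹' A) (V n ⁻¹' A))) l (𝓝 0))
    {A : Set E} (hA : MeasurableSet A) :
    Tendsto (fun n => P (symmDiff (U n ⁻¹' A) (V n ⁻¹' A))) l (𝓝 0) := by
  rw [hC] at hA
  induction A, hA using MeasurableSpace.generateFrom_induction with
  | hC A hA _ => exact h A hA
  | empty => simpa using tendsto_const_nhds
  | compl A _ hA => simpa only [Set.preimage_compl, compl_symmDiff_compl] using hA
  | iUnion f hfm hf =>
    have hfm' (k : ℕ) : MeasurableSet (f k) := by rw [hC]; exact hfm k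
    refine ENNReal.tendsto_nhds_zero.2 fun ε hε => ?_
    have hε3 : 0 < ε / 3 := ENNReal.div_pos hε.ne' (by norm_num)
    obtain ⟨N, hN⟩ := (ENNReal.tendsto_nhds_zero.1
      (tendsto_measure_iUnion_diff_accumulate (γ := γ) hfm') _ hε3).exists
    have hsum := tendsto_finsetSum (Finset.range (N + 1)) fun k _ => hf k
    rw [Finset.sum_const_zero] at hsum
    filter_upwards [ENNReal.tendsto_nhds_zero.1 hsum _ hε3] with n hn
    have hRm : MeasurableSet ((⋃ k, f k) \ Set.accumulate f N) :=
      (MeasurableSet.iUnion hfm').diff (measurableSet_accumulate hfm' N)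
    calc P (symmDiff (U n ⁻¹' ⋃ k, f k) (V n ⁻¹' ⋃ k, f k))
        ≤ P (U n ⁻¹' ((⋃ k, f k) \ Set.accumulate f N) ∪
            V n ⁻¹' ((⋃ k, f k) \ Set.accumulate f N) ∪
            ⋃ k ∈ Finset.range (N + 1), symmDiff (U n ⁻¹' f k) (V n ⁻¹' f k)) := by
          refine measure_mono fun x hx => ?_
          simp only [Set.mem_symmDiff, Set.mem_union, Set.mem_preimage, Set.mem_sdiff,
            Set.mem_iUnion, Set.mem_accumulate, Finset.mem_range, Nat.lt_succ_iff,
            exists_prop] at hx ⊢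
          by_contra! hcon
          obtain ⟨⟨h1, h2⟩, h3⟩ := hcon
          rcases hx with ⟨hx1, hx2⟩ | ⟨hx1, hx2⟩
          · obtain ⟨k, hk, hxk⟩ := h1 hx1
            exact hx2 ⟨k, (h3 k hk).1 hxk⟩
          · obtain ⟨k, hk, hxk⟩ := h2 hx1
            exact hx2 ⟨k, (h3 k hk).2 hxk⟩
      _ ≤ ε / 3 + ε / 3 + ε / 3 := by
          refine (measure_union_le _ _).trans (add_le_add ((measure_union_le _ _).trans
            (add_le_add ?_ ?_)) ((measure_biUnion_finset_le _ _).trans hn))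
          · rwa [(hU n).measure_preimage hRm.nullMeasurableSet]
          · rwa [(hV n).measure_preimage hRm.nullMeasurableSet]
      _ = ε := ENNReal.add_thirds ε

/-- If `U n - V n` tends to zero in measure and all `U n`, `V n` have the same law, then they fall
into a given Borel set simultaneously, up to a set of small measure. It suffices to treat
`A = Set.Iic c`, where the events can differ only if `|U n - V n|` is not small or one of the
variables is just above `c`. -/
theorem tendsto_measure_symmDiff_preimage_real {γ : Measure ℝ} [IsFiniteMeasure γ]
    {U V : ι → Ω → ℝ} (hU : ∀ n, MeasurePreserving (U n) P γ)
    (hV : ∀ n, MeasurePreserving (V n) P γ)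
    (h : ∀ δ > 0, Tendsto (fun n => P {x | δ ≤ |U n x - V n x|}) l (𝓝 0))
    {A : Set ℝ} (hA : MeasurableSet A) :
    Tendsto (fun n => P (symmDiff (U n ⁻¹' A) (V n ⁻¹' A))) l (𝓝 0) := by
  refine tendsto_measure_symmDiff_preimage_of_generateFrom hU hV
    ((BorelSpace.measurable_eq (α := ℝ)).trans (borel_eq_generateFrom_Iic ℝ)) ?_ hA
  rintro _ ⟨c, rfl⟩
  refine ENNReal.tendsto_nhds_zero.2 fun ε hε => ?_
  have hε3 : 0 < ε / 3 := ENNReal.div_pos hε.ne' (by norm_num)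
  have hIoo : Tendsto (fun δ => γ (Set.Ioo c (c + δ))) (𝓝[>] 0) (𝓝 0) := by
    have := tendsto_measure_biInter_gt (μ := γ) (a := (0 : ℝ)) (s := fun δ => Set.Ioo c (c + δ))
      (fun δ _ => measurableSet_Ioo.nullMeasurableSet)
      (fun i j _ hij => Set.Ioo_subset_Ioo_right (by linarith))
      ⟨1, one_pos, measure_ne_top _ _⟩
    have hempty : ⋂ δ > (0 : ℝ), Set.Ioo c (c + δ) = ∅ := by
      refine Set.eq_empty_of_forall_notMem fun x hx => ?_
      simp only [Set.mem_iInter, Set.mem_Ioo] at hx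
      linarith [(hx (x - c) (sub_pos.2 (hx 1 one_pos).1)).2]
    rwa [hempty, measure_empty] at this
  obtain ⟨δ, hδ, hδ0⟩ := ((ENNReal.tendsto_nhds_zero.1 hIoo _ hε3).and self_mem_nhdsWithin).exists
  filter_upwards [ENNReal.tendsto_nhds_zero.1 (h δ hδ0) _ hε3] with n hn
  calc P (symmDiff (U n ⁻¹' Set.Iic c) (V n ⁻¹' Set.Iic c))
      ≤ P (U n ⁻¹' Set.Ioo c (c + δ) ∪ V n ⁻¹' Set.Ioo c (c + δ) ∪
          {x | δ ≤ |U n x - V n x|}) := by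
        refine measure_mono fun x hx => ?_
        simp only [Set.mem_symmDiff, Set.mem_union, Set.mem_preimage, Set.mem_Iic, Set.mem_Ioo,
          Set.mem_ofPred_eq, not_le] at hx ⊢
        by_contra! hcon
        obtain ⟨⟨h1, h2⟩, h3⟩ := hcon
        rw [abs_lt] at h3
        rcases hx with ⟨hx1, hx2⟩ | ⟨hx1, hx2⟩
        · linarith [h2 hx2]
        · linarith [h1 hx2]
    _ ≤ ε / 3 + ε / 3 + ε / 3 := by
        refine (measure_union_le _ _).trans (add_le_add ((measure_union_le _ _).trans
          (add_le_add ?_ ?_)) hn)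
        · rwa [(hU n).measure_preimage measurableSet_Ioo.nullMeasurableSet]
        · rwa [(hV n).measure_preimage measurableSet_Ioo.nullMeasurableSet]
    _ = ε := ENNReal.add_thirds ε

/-- The version of `tendsto_measure_symmDiff_preimage_real` for random elements of `ℝ^T` whose
coordinates become close in measure; no uniformity in the coordinate is needed. -/
theorem tendsto_measure_symmDiff_preimage_pi {T : Type*} {γ : Measure (T → ℝ)}
    [IsFiniteMeasure γ] {U V : ι → Ω → T → ℝ} (hU : ∀ n, MeasurePreserving (U n) P γ)
    (hV : ∀ n, MeasurePreserving (V n) P γ)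
    (h : ∀ i, ∀ δ > 0, Tendsto (fun n => P {x | δ ≤ |U n x i - V n x i|}) l (𝓝 0))
    {A : Set (T → ℝ)} (hA : MeasurableSet A) :
    Tendsto (fun n => P (symmDiff (U n ⁻¹' A) (V n ⁻¹' A))) l (𝓝 0) := by
  refine tendsto_measure_symmDiff_preimage_of_generateFrom hU hV
    (MeasurableSpace.measurableSpace_iSup_eq _) ?_ hA
  rintro _ ⟨i, B, hB, rfl⟩
  have hi : MeasurePreserving (fun x : T → ℝ => x i) γ (γ.map fun x => x i) :=
    (measurable_pi_apply i).measurePreserving γ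
  exact tendsto_measure_symmDiff_preimage_real (fun n => hi.comp (hU n))
    (fun n => hi.comp (hV n)) (h i) hB

/-- Passage from sets to functions with countably many values. -/
theorem tendsto_measure_ne_of_symmDiff_preimage [MeasurableSpace E] {γ : Measure E}
    [IsFiniteMeasure γ] {U V : ι → Ω → E} (hU : ∀ n, MeasurePreserving (U n) P γ)
    (h : ∀ A, MeasurableSet A → Tendsto (fun n => P (symmDiff (U n ⁻¹' A) (V n ⁻¹' A))) l (𝓝 0))
    {f : E → ℕ} (hf : Measurable f) :
    Tendsto (fun n => P {x | f (U n x) ≠ f (V n x)}) l (𝓝 0) := by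
  have hfm (k : ℕ) : MeasurableSet (f ⁻¹' {k}) := hf (measurableSet_singleton k)
  refine ENNReal.tendsto_nhds_zero.2 fun ε hε => ?_
  have hε2 : 0 < ε / 2 := ENNReal.div_pos hε.ne' (by norm_num)
  obtain ⟨N, hN⟩ := (ENNReal.tendsto_nhds_zero.1
    (tendsto_measure_iUnion_diff_accumulate (γ := γ) hfm) _ hε2).exists
  have hsum := tendsto_finsetSum (Finset.range (N + 1)) fun k _ => h _ (hfm k)
  rw [Finset.sum_const_zero] at hsum
  filter_upwards [ENNReal.tendsto_nhds_zero.1 hsum _ hε2] with n hn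
  have hRm : MeasurableSet ((⋃ k, f ⁻¹' {k}) \ Set.accumulate (fun k => f ⁻¹' {k}) N) :=
    (MeasurableSet.iUnion hfm).diff (measurableSet_accumulate hfm N)
  calc P {x | f (U n x) ≠ f (V n x)}
      ≤ P (U n ⁻¹' ((⋃ k, f ⁻¹' {k}) \ Set.accumulate (fun k => f ⁻¹' {k}) N) ∪
          ⋃ k ∈ Finset.range (N + 1), symmDiff (U n ⁻¹' (f ⁻¹' {k})) (V n ⁻¹' (f ⁻¹' {k}))) := by
        refine measure_mono fun x hx => ?_
        simp only [Set.mem_symmDiff, Set.mem_union, Set.mem_preimage, Set.mem_sdiff,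
          Set.mem_iUnion, Set.mem_accumulate, Finset.mem_range, Nat.lt_succ_iff,
          Set.mem_singleton_iff, exists_eq', exists_prop, true_and, exists_eq_right',
          Set.mem_ofPred_eq] at hx ⊢
        by_cases hk : f (U n x) ≤ N
        · exact Or.inr ⟨_, hk, Or.inl ⟨rfl, fun e => hx e.symm⟩⟩
        · exact Or.inl hk
    _ ≤ ε / 2 + ε / 2 := by
        refine (measure_union_le _ _).trans
          (add_le_add ?_ ((measure_biUnion_finset_le _ _).trans hn))
        rwa [(hU n).measure_preimage hRm.nullMeasurableSet]
    _ = ε := ENNReal.add_halves ε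

end Agreement

/-! ### Coordinates on the space of the co-induced action -/

namespace PMPAction

/-- An isomorphism carries the joint law of an observable to that of the transported observable. -/
theorem map_observe_eq_of_intertwining {G X Y : Type*} [Group G] [MeasurableSpace X]
    [MeasurableSpace Y] {μ : Measure X} {ν : Measure Y} {a : PMPAction G X μ}
    {b : PMPAction G Y ν} {f : X → Y} {k : Y → X} (hf : MeasurePreserving f μ ν)
    (hk : Measurable k) (hkf : ∀ᵐ x ∂μ, k (f x) = x)
    (hab : ∀ g : G, ∀ᵐ x ∂μ, f (a.act g x) = b.act g (f x)) (F : Finset G) {φ : X → ℕ}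
    (hφ : Measurable φ) :
    μ.map (a.observe F φ) = ν.map (b.observe F (φ ∘ k)) := by
  have hb : Measurable (b.observe F (φ ∘ k)) := measurable_pi_lambda _ fun g =>
    (hφ.comp hk).comp (b.measurePreserving g).measurable
  refine Eq.trans ?_ ((Measure.map_map hb hf.measurable).symm.trans (congrArg _ hf.map_eq))
  refine Measure.map_congr ?_
  have h1 : ∀ᵐ x ∂μ, ∀ g : F, k (f (a.act g x)) = a.act g x :=
    ae_all_iff.2 fun g => (a.measurePreserving g).quasiMeasurePreserving.ae hkf
  have h2 : ∀ᵐ x ∂μ, ∀ g : F, f (a.act g x) = b.act g (f x) := ae_all_iff.2 fun g => hab g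
  filter_upwards [h1, h2] with x hx1 hx2
  funext g
  simp only [observe, Function.comp_apply]
  rw [← hx2 g, hx1 g]

section CoindCoord

variable {G : Type*} [Group G] {H : Subgroup G} {X : Type*} [MeasurableSpace X] {μ : Measure X}

/-- The coordinate `a(x) z(x)`, for `x` in the coset `q`, of a point `z` of the space of the
co-induced action of `a | H`. The section `σ` only serves to choose the representative `x`. -/
def coindCoord (a : PMPAction G X μ) (σ : CosetSection H) (z : (a.restrict H).CoindSpace)
    (q : G ⧸ H) : X :=
  a.act (σ.toFun q) (z.1 (σ.toFun q))

/-- The coordinate at a coset does not depend on the representative, because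
`z(xh) = a(h⁻¹) z(x)`. -/
theorem coindCoord_mk (a : PMPAction G X μ) (σ : CosetSection H)
    (z : (a.restrict H).CoindSpace) (x : G) : a.coindCoord σ z x = a.act x (z.1 x) := by
  have h : z.1 x = a.act ((sectionDiff σ x : H) : G)⁻¹ (z.1 (σ.toFun (x : G ⧸ H))) := by
    conv_lhs => rw [← section_mul_sectionDiff σ x]
    exact (z.2 (sectionDiff σ x) (σ.toFun (x : G ⧸ H))).symm
  rw [h, ← a.mul_act, coindCoord]
  congr 1
  rw [eq_mul_inv_iff_mul_eq, section_mul_sectionDiff]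

/-- In these coordinates the co-induced action is the permutation of the factors combined with the
diagonal action of `G` by `a`. -/
theorem coindCoord_coindAct (a : PMPAction G X μ) (σ : CosetSection H)
    (z : (a.restrict H).CoindSpace) (g : G) (q : G ⧸ H) :
    a.coindCoord σ ((a.restrict H).coindAct g z) q = a.act g (a.coindCoord σ z (g⁻¹ • q)) := by
  induction q using QuotientGroup.induction_on with
  | H x =>
    have e : g⁻¹ • (x : G ⧸ H) = ((g⁻¹ * x : G) : G ⧸ H) := rfl
    rw [e, coindCoord_mk, coindCoord_mk, ← a.mul_act, mul_inv_cancel_left]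
    rfl

theorem measurePreserving_coindCoord (a : PMPAction G X μ) (σ : CosetSection H) :
    MeasurePreserving (a.coindCoord σ) ((a.restrict H).coindMeasure σ)
      (Measure.infinitePi fun _ : G ⧸ H => μ) := by
  have := a.isProbabilityMeasure
  have h : MeasurePreserving (fun (y : G ⧸ H → X) q => a.act (σ.toFun q) (y q))
      (Measure.infinitePi fun _ : G ⧸ H => μ) (Measure.infinitePi fun _ : G ⧸ H => μ) := by
    refine ⟨measurable_pi_lambda _ fun q =>
      (a.measurePreserving _).measurable.comp (measurable_pi_apply q), ?_⟩
    rw [Measure.infinitePi_map_pi (fun _ : G ⧸ H => μ) (f := fun q => a.act (σ.toFun q))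
      fun q => (a.measurePreserving _).measurable]
    congr 1
    funext q
    exact (a.measurePreserving _).map_eq
  exact h.comp ((a.restrict H).measurePreserving_coindEquiv σ)

end CoindCoord

end PMPAction

/-! ### Averages of the Gaussian coordinates over cosets -/

section Averaging

open Filter Topology

variable {G : Type*} [Group G] {H : Subgroup G} {X T : Type*} [MeasurableSpace X] {μ : Measure X}

/-- The random element `∑ q ∈ s, c q • f (w q)` of `ℝ^T`, where `w` is the family of coordinates of
`z` given by `PMPAction.coindCoord`. -/
def coindAverage (a : PMPAction G X μ) (σ : CosetSection H) (f : X → T → ℝ)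
    (s : Finset (G ⧸ H)) (c : G ⧸ H → ℝ) (z : (a.restrict H).CoindSpace) (i : T) : ℝ :=
  ∑ q ∈ s, c q * f (a.coindCoord σ z q) i

theorem measurePreserving_comp_coindCoord (a : PMPAction G X μ) (σ : CosetSection H)
    {γ : Measure (T → ℝ)} {f : X → T → ℝ} (hf : MeasurePreserving f μ γ) :
    MeasurePreserving (fun z q => f (a.coindCoord σ z q)) ((a.restrict H).coindMeasure σ)
      (Measure.infinitePi fun _ : G ⧸ H => γ) := by
  have := a.isProbabilityMeasure
  refine MeasurePreserving.comp (g := fun (y : G ⧸ H → X) q => f (y q)) ⟨measurable_pi_lambda _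
    fun q => hf.measurable.comp (measurable_pi_apply q), ?_⟩ (a.measurePreserving_coindCoord σ)
  rw [Measure.infinitePi_map_pi (fun _ : G ⧸ H => μ) (f := fun _ => f) fun _ => hf.measurable]
  simp only [hf.map_eq]

theorem measurable_coindAverage (a : PMPAction G X μ) (σ : CosetSection H)
    {f : X → T → ℝ} (hf : Measurable f) (s : Finset (G ⧸ H)) (c : G ⧸ H → ℝ) :
    Measurable (coindAverage a σ f s c) := by
  have h (q : G ⧸ H) : Measurable fun z => a.coindCoord σ z q :=
    (measurable_pi_apply q).comp (a.measurePreserving_coindCoord σ).measurable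
  unfold coindAverage
  fun_prop

theorem isGaussianMeasure_map_coindAverage (a : PMPAction G X μ) (σ : CosetSection H)
    {φ : T → T → ℝ} (hφ : IsPosDefFun φ) {γ : Measure (T → ℝ)} (hγ : IsGaussianMeasure φ γ)
    {f : X → T → ℝ} (hf : MeasurePreserving f μ γ) (s : Finset (G ⧸ H)) (c : G ⧸ H → ℝ) :
    IsGaussianMeasure (fun i j => (∑ q ∈ s, c q ^ 2) * φ i j)
      (((a.restrict H).coindMeasure σ).map (coindAverage a σ f s c)) := by
  have hW := measurePreserving_comp_coindCoord a σ hf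
  have h := hγ.map_sum_infinitePi hφ s c
  rw [← hW.map_eq, Measure.map_map (by fun_prop) hW.measurable] at h
  exact h

theorem measurePreserving_coindAverage (a : PMPAction G X μ) (σ : CosetSection H)
    {φ : T → T → ℝ} (hφ : IsPosDefFun φ) {γ : Measure (T → ℝ)} (hγ : IsGaussianMeasure φ γ)
    {f : X → T → ℝ} (hf : MeasurePreserving f μ γ) {s : Finset (G ⧸ H)} {c : G ⧸ H → ℝ}
    (hc : ∑ q ∈ s, c q ^ 2 = 1) :
    MeasurePreserving (coindAverage a σ f s c) ((a.restrict H).coindMeasure σ) γ := by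
  refine ⟨measurable_coindAverage a σ hf.measurable s c, ?_⟩
  have h := isGaussianMeasure_map_coindAverage a σ hφ hγ hf s c
  simp only [hc, one_mul] at h
  exact h.unique hγ

/-- The failure of equivariance of an average with weights `ξ` is, up to the action of `g`, an
average with weights `ξ (g • q) - ξ q`. -/
theorem coindAverage_coindAct_sub [Countable G] [MulAction G T] (a : PMPAction G X μ)
    (σ : CosetSection H) {f : X → T → ℝ} {g : G}
    (hfg : ∀ᵐ x ∂μ, f (a.act g x) = fun i => f x (g⁻¹ • i)) (ξ : G ⧸ H →₀ ℝ) :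
    ∃ s : Finset (G ⧸ H), ∀ᵐ z ∂(a.restrict H).coindMeasure σ, ∀ i : T,
      coindAverage a σ f ξ.support ξ ((a.restrict H).coindAct g z) i -
          coindAverage a σ f ξ.support ξ z (g⁻¹ • i) =
        coindAverage a σ f s (fun q => ξ (g • q) - ξ q) z (g⁻¹ • i) := by
  classical
  have := a.isProbabilityMeasure
  have : Countable (G ⧸ H) := QuotientGroup.mk_surjective.countable
  have hae : ∀ᵐ z ∂(a.restrict H).coindMeasure σ, ∀ q : G ⧸ H,
      f (a.act g (a.coindCoord σ z q)) = fun i => f (a.coindCoord σ z q) (g⁻¹ • i) :=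
    ae_all_iff.2 fun q => ((measurePreserving_eval_infinitePi (fun _ : G ⧸ H => μ) q).comp
      (a.measurePreserving_coindCoord σ)).quasiMeasurePreserving.ae hfg
  -- a finite set containing the supports of `ξ` and of `q ↦ ξ (g • q)`
  let S : Finset (G ⧸ H) := ξ.support ∪ ξ.support.image (g⁻¹ • ·)
  refine ⟨S, ?_⟩
  filter_upwards [hae] with z hz i
  simp only [coindAverage, PMPAction.coindCoord_coindAct, hz, sub_mul, Finset.sum_sub_distrib]
  congr 1
  · calc ∑ q ∈ ξ.support, ξ q * f (a.coindCoord σ z (g⁻¹ • q)) (g⁻¹ • i)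
        = ∑ q ∈ ξ.support.image (g⁻¹ • ·), ξ (g • q) * f (a.coindCoord σ z q) (g⁻¹ • i) := by
          rw [Finset.sum_image fun q _ q' _ h => MulAction.injective g⁻¹ h]
          simp only [smul_inv_smul]
      _ = _ := by
          refine Finset.sum_subset Finset.subset_union_right fun q _ hq => ?_
          have : ξ (g • q) = 0 := by
            by_contra h0
            exact hq (Finset.mem_image.2 ⟨g • q, Finsupp.mem_support_iff.2 h0, inv_smul_smul g q⟩)
          rw [this, zero_mul]
  · refine Finset.sum_subset Finset.subset_union_left fun q _ hq => ?_
    rw [Finsupp.notMem_support_iff.1 hq, zero_mul]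

theorem tendsto_measure_abs_coindAverage_sub [Countable G] [MulAction G T]
    (a : PMPAction G X μ) (σ : CosetSection H) {φ : T → T → ℝ} (hφ : IsPosDefFun φ)
    {γ : Measure (T → ℝ)} (hγ : IsGaussianMeasure φ γ) {f : X → T → ℝ}
    (hf : MeasurePreserving f μ γ) {g : G}
    (hfg : ∀ᵐ x ∂μ, f (a.act g x) = fun i => f x (g⁻¹ • i)) {ξ : ℕ → G ⧸ H →₀ ℝ}
    (hξ : ∀ n : ℕ, ∀ s : Finset (G ⧸ H),
      ∑ q ∈ s, (ξ n (g • q) - ξ n q) ^ 2 ≤ 1 / ((n : ℝ) + 1)) (i : T) {δ : ℝ} (hδ : 0 < δ) :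
    Tendsto (fun n => (a.restrict H).coindMeasure σ
      {z | δ ≤ |coindAverage a σ f (ξ n).support (ξ n) ((a.restrict H).coindAct g z) i -
        coindAverage a σ f (ξ n).support (ξ n) z (g⁻¹ • i)|}) atTop (𝓝 0) := by
  have hφ0 : 0 ≤ φ (g⁻¹ • i) (g⁻¹ • i) := by simpa using hφ.nonneg {g⁻¹ • i} 1
  have hlim : Tendsto (fun n : ℕ => ENNReal.ofReal
      (1 / ((n : ℝ) + 1) * (φ (g⁻¹ • i) (g⁻¹ • i) / δ ^ 2))) atTop (𝓝 0) := by
    rw [← ENNReal.ofReal_zero]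
    refine ENNReal.tendsto_ofReal ?_
    simpa using tendsto_one_div_add_atTop_nhds_zero_nat.mul_const
      (φ (g⁻¹ • i) (g⁻¹ • i) / δ ^ 2)
  refine tendsto_of_tendsto_of_tendsto_of_le_of_le tendsto_const_nhds hlim (fun _ => bot_le)
    fun n => ?_
  obtain ⟨s, hs⟩ := coindAverage_coindAct_sub a σ hfg (ξ n)
  let c : G ⧸ H → ℝ := fun q => ξ n (g • q) - ξ n q
  have hG := isGaussianMeasure_map_coindAverage a σ hφ hγ hf s c
  have := hG.isProbabilityMeasure
  calc (a.restrict H).coindMeasure σ _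
      = (a.restrict H).coindMeasure σ {z | δ ≤ |coindAverage a σ f s c z (g⁻¹ • i)|} := by
        refine measure_congr ?_
        filter_upwards [hs] with z hz
        exact congrArg (fun r : ℝ => δ ≤ |r|) (hz i)
    _ = ((a.restrict H).coindMeasure σ).map (coindAverage a σ f s c)
          {x | δ ≤ |x (g⁻¹ • i)|} := by
        rw [Measure.map_apply (measurable_coindAverage a σ hf.measurable s c)
          (measurableSet_le measurable_const (by fun_prop))]
        rfl
    _ ≤ ENNReal.ofReal (1 / ((n : ℝ) + 1) * (φ (g⁻¹ • i) (g⁻¹ • i) / δ ^ 2)) := by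
        rw [← ofReal_measureReal]
        refine ENNReal.ofReal_le_ofReal ((hG.measureReal_abs_ge_le _ hδ).trans ?_)
        rw [mul_div_assoc]
        exact mul_le_mul_of_nonneg_right (hξ n s) (by positivity)

end Averaging

open Filter Topology in
theorem mainTheorem3 {G : Type u} [Group G] [Countable G] (H : Subgroup G)
    (hH : IsAmenableAction G (G ⧸ H))
    {X : Type v} [MeasurableSpace X] [StandardBorelSpace X] {μ : Measure X}
    (a : PMPAction G X μ) (ha : IsGaussianAction.{w} a) (σ : CosetSection H) :
    a.WeaklyContained ((a.restrict H).coind σ) := by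
  obtain ⟨T, _, _, φ, hφ, hinv, γ, hγ, f, k, hf, hk, hkf, -, hfa⟩ := ha
  intro ε hε F ob hob
  have := hγ.isProbabilityMeasure
  let ζ := (a.restrict H).coindMeasure σ
  have hζ : IsProbabilityMeasure ζ := ((a.restrict H).coind σ).isProbabilityMeasure
  choose ξ hξ1 hξ using fun n : ℕ =>
    hH.exists_almost_invariant_unit_vector F (Nat.one_div_pos_of_nat (α := ℝ) (n := n))
  let Y : ℕ → (a.restrict H).CoindSpace → T → ℝ := fun n =>
    coindAverage a σ f (ξ n).support (ξ n)
  have hY (n : ℕ) : MeasurePreserving (Y n) ζ γ :=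
    measurePreserving_coindAverage a σ hφ hγ hf (hξ1 n)
  let b := gaussianShift hγ hinv
  -- the observable carried over to the Gaussian shift
  let θ : (T → ℝ) → ℕ := ob ∘ k
  have hθ : Measurable θ := hob.comp hk.measurable
  have hagree (g : G) (hg : g ∈ F) : Tendsto (fun n =>
      ζ {z | θ (Y n ((a.restrict H).coindAct g z)) ≠ θ (b.act g (Y n z))}) atTop (𝓝 0) := by
    have hU (n : ℕ) := (hY n).comp ((a.restrict H).measurePreserving_coindAct σ g)
    have hV (n : ℕ) := (b.measurePreserving g).comp (hY n)
    exact tendsto_measure_ne_of_symmDiff_preimage hU (fun A hA =>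
      tendsto_measure_symmDiff_preimage_pi hU hV (fun i δ hδ =>
        tendsto_measure_abs_coindAverage_sub a σ hφ hγ hf (hfa g) (fun n => hξ n g hg) i hδ) hA) hθ
  have hsum := tendsto_finsetSum F hagree
  rw [Finset.sum_const_zero] at hsum
  obtain ⟨n, hn⟩ := (ENNReal.tendsto_nhds_zero.1 hsum _
    (ENNReal.ofReal_pos.2 (half_pos hε))).exists
  refine ⟨θ ∘ Y n, hθ.comp (hY n).measurable, ?_⟩
  have hb : Measurable (b.observe F θ) := measurable_pi_lambda _ fun g =>
    hθ.comp (b.measurePreserving g).measurable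
  have hc : Measurable (((a.restrict H).coind σ).observe F (θ ∘ Y n)) :=
    measurable_pi_lambda _ fun g => (hθ.comp (hY n).measurable).comp
      (((a.restrict H).coind σ).measurePreserving g).measurable
  rw [PMPAction.map_observe_eq_of_intertwining (b := b) hf hk.measurable hkf hfa F hob,
    show γ.map (b.observe F θ) = ζ.map (b.observe F θ ∘ Y n) from
      (congrArg _ (hY n).map_eq.symm).trans (Measure.map_map hb (hY n).measurable)]
  refine (PMPAction.l1Dist_map_le (hb.comp (hY n).measurable) hc).trans ?_
  have hle : ζ.real {z | (b.observe F θ ∘ Y n) z ≠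
      ((a.restrict H).coind σ).observe F (θ ∘ Y n) z} ≤ ε / 2 := by
    refine ENNReal.toReal_le_of_le_ofReal (half_pos hε).le (le_trans ?_ hn)
    refine (measure_mono fun z hz => ?_).trans (measure_biUnion_finset_le F _)
    obtain ⟨g, hg⟩ := Function.ne_iff.1 hz
    exact Set.mem_biUnion g.2 (Ne.symm hg)
  linarith
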